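/- **Setting.** Let $\mathcal X\subset\mathbb R^{n_x}$ be compact, $\mathcal Z\subseteq\mathbb R^{n_z}$, let $f:\mathcal X\to\mathbb R^{n_x}$ and $h:\mathcal X\to\mathbb R^{n_y}$ be continuous, $A\in\mathbb R^{n_z\times n_z}$, $B\in\mathbb R^{n_z\times n_y}$, $\nu>0$, and let $\|\cdot\|$ be the Euclidean norm. Let $\mathcal T:\mathcal X\to\mathcal Z$ be continuous with a left inverse $\mathcal T^*$, i.e. $\mathcal T^*(\mathcal T(x))=x$ for all $x\in\mathcal X$ (in the application $\mathcal T$ is the KKL transformation, a solution of $\frac{\partial\mathcal T}{\partial x}f=A\mathcal T+Bh$, but this is not needed). Let $\mathcal D$ be a Borel probability measure on $\mathcal X$ and $\mu_{\mathcal T}$ its image under $\mathcal T$. Let $\mathcal H_\theta$ be a class of maps $\hat{\mathcal T}_\theta:\mathcal X\to\mathcal Z$ that are differentiable at every point of $\mathcal X$ (as maps on $\mathbb R^{n_x}$) with derivative continuous on $\mathcal X$, and put $$\mathcal P_\theta(x)=\tfrac{\partial\hat{\mathcal T}_\theta}{\partial x}(x)f(x)-A\hat{\mathcal T}_\theta(x)-Bh(x).$$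 Let $\mathcal H_\eta$ be a class of maps $\hat{\mathcal T}^*_\eta:\mathcal Z\to\mathbb R^{n_x}$, each Lipschitz on $\mathcal Z$ with a constant $\ell_\eta>0$ that may depend on the map. **Two-stage method.** Let $N_{\mathrm{data}},N_{\mathrm{pde}},N_2\ge1$ and $N_1=N_{\mathrm{data}}+N_{\mathrm{pde}}$. Draw $N_1+N_2$ points of $\mathcal X$ independently from $\mathcal D$: points $x_i$ with labels $z_i=\mathcal T(x_i)$, $i\le N_{\mathrm{data}}$, collocation points $\bar x_j$, $j\le N_{\mathrm{pde}}$, and points $x_k'$, $k\le N_2$. Let $S_1$ consist of the $(x_i,z_i)$ and the $\bar x_j$. The first stage chooses, as a measurable function of $S_1$, a minimizer $\hat{\mathcal T}_\theta$ over $\mathcal H_\theta$ of $$\hat R_{S_1}(\theta)=\frac1{N_{\mathrm{data}}}\sum_i\|z_i-\hat{\mathcal T}_\theta(x_i)\|^2+\frac{\nu}{N_{\mathrm{pde}}}\sum_j\|\mathcal P_\theta(\bar x_j)\|^2 .$$ The second stage sets $z_k'=\hat{\mathcal T}_\theta(x_k')$, $S_2=\{(x_k',z_k')\}$, and chooses a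 minimizer $\hat{\mathcal T}^*_\eta$ over $\mathcal H_\eta$ of $$\hat R_{S_2}(\eta\mid\theta)=\frac1{N_2}\sum_k\|x_k'-\hat{\mathcal T}^*_\eta(z_k')\|^2 .$$ Such minimizers are assumed to exist. **Loss classes.** A finite set of points $p_1,\dots,p_m$ is shattered by a class $\mathcal G$ of real functions if there are $\tau_1,\dots,\tau_m\in\mathbb R$ such that for every $b\in\{-1,1\}^m$ some $g\in\mathcal G$ has $\operatorname{sign}(g(p_i)-\tau_i)=b_i$ for all $i$; $\mathrm{Pdim}(\mathcal G)$ is the largest size of a shattered set. The second-stage loss class is $\mathcal G_\eta=\{(x',z')\mapsto\|x'-\hat{\mathcal T}^*_\eta(z')\|^2:\hat{\mathcal T}_\eta^*\in\mathcal H_\eta\}$ on $\mathcal X\times\mathcal Z$. The first-stage loss class $\mathcal G_\theta$ consists, for $\hat{\mathcal T}_\theta\in\mathcal H_\theta$, of the functions $g_\theta$ on the disjoint union $(\mathcal X\times\mathcal Z)\sqcup\mathcal X$ of labelled and collocation points, $$g_\theta(x,z)=\tfrac{N_1}{N_{\mathrm{data}}}\|z-\hat{\mathcal T}_\theta(x)\|^2,\qquad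 g_\theta(x)=\tfrac{N_1}{N_{\mathrm{pde}}}\,\nu\,\|\mathcal P_\theta(x)\|^2,$$ so that $\hat R_{S_1}(\theta)$ is the average of $g_\theta$ over the $N_1$ points of $S_1$. Assume that $d_\theta=\mathrm{Pdim}(\mathcal G_\theta)$ and $d_\eta=\mathrm{Pdim}(\mathcal G_\eta)$ are finite, that $N_1\ge d_\theta$ and $N_2\ge d_\eta$, and that the losses are bounded: for all $x\in\mathcal X$, $g_\theta(x,\mathcal T(x))\le M_\theta$ and $g_\theta(x)\le M_\theta$ for every $\hat{\mathcal T}_\theta\in\mathcal H_\theta$, and $\|x-\hat{\mathcal T}^*_\eta(\hat{\mathcal T}_\theta(x))\|^2\le M_\eta$ for every $\hat{\mathcal T}^*_\eta\in\mathcal H_\eta$ and every map $\hat{\mathcal T}_\theta$ that the first stage can return. **Theorem.** For every $\delta>0$, with probability at least $1-2\delta$ over $(S_1,S_2)$, the learned maps satisfy $$R_{\mathcal T^*}(\eta)\le 2\bigl(\hat R_2+2\,\mathcal C_\eta\bigr)+2\ell_\eta^2\bigl(\hat R_1+2\,\mathcal C_\theta\bigr),$$ where $R_{\mathcal T^*}(\eta)=\int\|\mathcal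 T^*(z)-\hat{\mathcal T}^*_\eta(z)\|^2\,\mathrm d\mu_{\mathcal T}(z)$ is the inverse map error, $\ell_\eta$ is the Lipschitz constant of the learned $\hat{\mathcal T}^*_\eta$, $\hat R_2=\inf_{\hat\eta\in\mathcal H_\eta}\hat R_{S_2}(\hat\eta\mid\theta)$ with $\theta$ the learned forward map, $\hat R_1=\inf_{\hat\theta\in\mathcal H_\theta}\hat R_{S_1}(\hat\theta)$, and, for $(\mathcal C,M,d,N)=(\mathcal C_\eta,M_\eta,d_\eta,N_2)$ and $(\mathcal C_\theta,M_\theta,d_\theta,N_1)$, $$\mathcal C=M\sqrt{\frac{2d\ln(eN/d)}{N}}+M\sqrt{\frac{\ln(1/\delta)}{2N}}$$ (with $d\ln(eN/d)=0$ for $d=0$, and the square root of a negative number, which occurs only if $\delta>1$, read as $0$). For fixed $M,d,\delta$, both complexity terms tend to $0$ as $N\to\infty$. -/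

import Mathlib

open MeasureTheory Filter Topology

namespace KKL

/-- Euclidean space of dimension `n`, with the Euclidean norm. -/
abbrev E (n : ℕ) : Type := EuclideanSpace ℝ (Fin n)

section LearningTheory

/-- A finite set `s` of points is shattered by a class `G` of real functions if, for suitable
thresholds `τ`, every labelling of `s` by signs `±1` is realized by `sign (g - τ)`, `g ∈ G`. -/
def Shatters {α : Type*} (G : Set (α → ℝ)) (s : Finset α) : Prop :=
  ∃ τ : α → ℝ, ∀ b : α → SignType, (∀ a ∈ s, b a ≠ 0) →
    ∃ g ∈ G, ∀ a ∈ s, SignType.sign (g a - τ a) = b a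

/-- The pseudo-dimension: the size of the largest shattered set (`⊤` if there is none). -/
noncomputable def pdim {α : Type*} (G : Set (α → ℝ)) : ℕ∞ :=
  ⨆ s : {s : Finset α // Shatters G s}, (s.1.card : ℕ∞)

/-- The complexity term `M √(2 d ln(e N / d) / N) + M √(ln(1/δ) / (2 N))`.
For `d = 0` the first summand is `0`. -/
noncomputable def complexity (M : ℝ) (d N : ℕ) (δ : ℝ) : ℝ :=
  M * √(2 * d * Real.log (Real.exp 1 * N / d) / N) + M * √(Real.log (1 / δ) / (2 * N))

/-- The property `good` holds with probability at least `p`: it holds on a measurable event of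
probability at least `p` (no measurability of `good` itself is asked for). -/
def HoldsWithProb {Ω : Type*} [MeasurableSpace Ω] (P : Measure Ω) (p : ℝ) (good : Ω → Prop) :
    Prop :=
  ∃ S : Set Ω, MeasurableSet S ∧ (∀ ω ∈ S, good ω) ∧ ENNReal.ofReal p ≤ P S

end LearningTheory

section Risks

variable {nx ny nz : ℕ}

/-- The PDE residual `(∂θ/∂x)(x) f(x) - A θ(x) - B h(x)`. -/
noncomputable def pdeResidual (f : E nx → E nx) (h : E nx → E ny)
    (A : Matrix (Fin nz) (Fin nz) ℝ) (B : Matrix (Fin nz) (Fin ny) ℝ)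
    (θ : E nx → E nz) (x : E nx) : E nz :=
  fderiv ℝ θ x (f x) - Matrix.toEuclideanLin A (θ x) - Matrix.toEuclideanLin B (h x)

/-- The inverse map error: the mean of `‖T*(z) - η(z)‖²` for `z` distributed as the image of
the data distribution `D` under `T`. -/
noncomputable def invError {X : Set (E nx)} (D : Measure X) (T : E nx → E nz)
    (Tinv η : E nz → E nx) : ℝ :=
  ∫ z, ‖Tinv z - η z‖ ^ 2 ∂(D.map fun x : X => T x)

/-- The empirical physics-informed risk of `θ` on the labelled data `(xᵢ, zᵢ)` and the
collocation points `xⱼ`. -/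
noncomputable def empPhysRisk (f : E nx → E nx) (h : E nx → E ny)
    (A : Matrix (Fin nz) (Fin nz) ℝ) (B : Matrix (Fin nz) (Fin ny) ℝ) (ν : ℝ)
    {Nd Np : ℕ} (data : Fin Nd → E nx × E nz) (col : Fin Np → E nx) (θ : E nx → E nz) : ℝ :=
  1 / Nd * ∑ i, ‖(data i).2 - θ (data i).1‖ ^ 2 +
    ν / Np * ∑ j, ‖pdeResidual f h A B θ (col j)‖ ^ 2

/-- The loss of `θ` at a single point of the first data set, which is either a labelled point
`(x, z)` or a collocation point `x`. The two kinds carry the weights that make the empirical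
physics-informed risk the plain average of this loss over all `Nd + Np` points
(see `empPhysRisk_eq_average`). -/
noncomputable def physLoss (f : E nx → E nx) (h : E nx → E ny)
    (A : Matrix (Fin nz) (Fin nz) ℝ) (B : Matrix (Fin nz) (Fin ny) ℝ) (ν : ℝ) (Nd Np : ℕ)
    (θ : E nx → E nz) : (E nx × E nz) ⊕ E nx → ℝ
  | Sum.inl p => ((Nd + Np : ℕ) : ℝ) / Nd * ‖p.2 - θ p.1‖ ^ 2
  | Sum.inr x => ((Nd + Np : ℕ) : ℝ) / Np * (ν * ‖pdeResidual f h A B θ x‖ ^ 2)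

theorem empPhysRisk_eq_average (f : E nx → E nx) (h : E nx → E ny)
    (A : Matrix (Fin nz) (Fin nz) ℝ) (B : Matrix (Fin nz) (Fin ny) ℝ) (ν : ℝ)
    {Nd Np : ℕ} (hd : 0 < Nd) (data : Fin Nd → E nx × E nz) (col : Fin Np → E nx)
    (θ : E nx → E nz) :
    empPhysRisk f h A B ν data col θ = 1 / ((Nd + Np : ℕ) : ℝ) *
      ∑ k : Fin Nd ⊕ Fin Np, physLoss f h A B ν Nd Np θ (Sum.map data col k) := by
  have h1 : ((Nd + Np : ℕ) : ℝ) ≠ 0 := by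
    have : 0 < Nd + Np := by omega
    exact_mod_cast this.ne'
  simp only [empPhysRisk, Fintype.sum_sum_type, Sum.map_inl, Sum.map_inr, physLoss,
    ← Finset.mul_sum, mul_add]
  congr 1 <;> field_simp

/-- The empirical reconstruction risk of `η` on the pairs `(x'ⱼ, z'ⱼ)`. -/
noncomputable def empRecRisk {N : ℕ} (data : Fin N → E nx × E nz) (η : E nz → E nx) : ℝ :=
  1 / N * ∑ j, ‖(data j).1 - η (data j).2‖ ^ 2

/-- The loss class of the first stage, on labelled points in `X × Z` and collocation points
in `X`. -/
noncomputable def physLossClass (f : E nx → E nx) (h : E nx → E ny)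
    (A : Matrix (Fin nz) (Fin nz) ℝ) (B : Matrix (Fin nz) (Fin ny) ℝ) (ν : ℝ) (Nd Np : ℕ)
    (X : Set (E nx)) (Z : Set (E nz)) (H : Set (E nx → E nz)) : Set ((X × Z) ⊕ X → ℝ) :=
  {g | ∃ θ ∈ H, g = fun p =>
    physLoss f h A B ν Nd Np θ (Sum.map (fun q : X × Z => ((q.1 : E nx), (q.2 : E nz)))
      (fun x : X => (x : E nx)) p)}

/-- The loss class `{(x', z') ↦ ‖x' - η(z')‖² : η ∈ H}` of the second stage, on `X × Z`. -/
def recLossClass (X : Set (E nx)) (Z : Set (E nz)) (H : Set (E nz → E nx)) :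
    Set (X × Z → ℝ) :=
  {g | ∃ η ∈ H, g = fun p => ‖(p.1 : E nx) - η p.2‖ ^ 2}

/-- The labelled data `(xᵢ, T(xᵢ))` attached to points `xᵢ` of `X`. -/
def labelled {X : Set (E nx)} {N : ℕ} (T : E nx → E nz) (x : Fin N → X) :
    Fin N → E nx × E nz :=
  fun i => ((x i : E nx), T (x i))

end Risks

end KKL

/-! Since `Tinv` inverts `T` on `X`, the inverse error is the mean of `‖x - η (T x)‖²`. Replacing `T
x` by `θ x` moves the value of `η` by at most `ℓ ‖T x - θ x‖`, so `(a + b)² ≤ 2a² + 2b²` bounds the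
error by twice the true reconstruction risk plus `2ℓ²` times the true data risk of `θ`
(`integral_inverse_le`). The data risk is at most the physics-informed risk, whose PDE term is
nonnegative. It remains to bound true risks by empirical ones uniformly over each class, which
covers any choice of minimizer.

The uniform bound is `measure_deviation_le`. A value `v` in `[0, 1]` is the mean of the indicator of
`t < v` over a uniform threshold `t`. With one threshold per index and a ghost sample, Jensen's
inequality turns the exponential of a deviation into a mean over indicators; exchanging sample and
ghost points then produces random signs. For fixed points and thresholds only the labellings of `2N`
points matter, and Sauer–Shelah counts them by the pseudo-dimension. Rademacher moments and Markov's
inequality give the tail `(2eN/d)^d exp(-Nε²/2)`, which is at most `δ` at `ε = 2𝒞/M`.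

Events over uncountable classes are made measurable by testing on countable subclasses. The
second-stage labels depend on the first sample, so the bound is applied for each fixed first sample
and then integrated. -/

namespace KKL

/-! ### Pseudo-dimension and the growth function -/

/-- The labellings of the points `p i` by `G`, with thresholds `τ i`, shatter only index sets
whose size is at most the pseudo-dimension of `G`. -/
theorem vcDim_le_of_pdim_le {α ι : Type*} [DecidableEq ι] {G : Set (α → ℝ)} {d : ℕ}
    (hG : pdim G ≤ d) (p : ι → α) (τ : ι → ℝ) (𝒜 : Finset (Finset ι))
    (h𝒜 : ∀ s ∈ 𝒜, ∃ g ∈ G, ∀ i, i ∈ s ↔ τ i < g (p i)) : 𝒜.vcDim ≤ d := by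
  classical
  refine Finset.sup_le fun s hs => ?_
  have hs : 𝒜.Shatters s := Finset.mem_shatterer.1 hs
  have hsub : ∀ t ⊆ s, ∃ g ∈ G, ∀ i ∈ s, i ∈ t ↔ τ i < g (p i) := by
    intro t ht
    obtain ⟨u, hu, hut⟩ := hs ht
    obtain ⟨g, hg, hgu⟩ := h𝒜 u hu
    refine ⟨g, hg, fun i hi => ?_⟩
    rw [← hgu, ← hut, Finset.mem_inter]
    exact and_iff_right hi
  -- If two indices shared a point, a function above the larger threshold would also be above the
  -- smaller one, so one of the four labellings would be missing.
  have hinj : Set.InjOn p s := by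
    have key : ∀ i ∈ s, ∀ j ∈ s, p i = p j → τ i ≤ τ j → i = j := by
      intro i hi j hj hij hτ
      by_contra hne
      obtain ⟨g, -, hg⟩ := hsub {j} (by simpa using hj)
      have h1 := (hg j hj).1 (by simp)
      have h2 := (hg i hi).not.1 (by simpa using hne)
      rw [hij] at h2
      exact h2 (hτ.trans_lt h1)
    intro i hi j hj hij
    rcases le_total (τ i) (τ j) with h | h
    · exact key i hi j hj hij h
    · exact (key j hj i hi hij.symm h).symm
  choose! γ hγG hγ using hsub
  -- Labellings here allow the tie `γ r (p i) = τ i`, whereas shattering needs nonzero signs. As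
  -- only finitely many `γ r` occur, each threshold can be raised slightly so that ties fall
  -- strictly below and strict excesses survive.
  have hε : ∀ i ∈ s, ∃ t, τ i < t ∧ ∀ r ∈ s.powerset, τ i < γ r (p i) → t < γ r (p i) := by
    intro i _
    have : ∀ᶠ t in 𝓝[>] τ i, ∀ r ∈ s.powerset, τ i < γ r (p i) → t < γ r (p i) := by
      rw [Filter.eventually_all_finset]
      intro r _
      by_cases h : τ i < γ r (p i)
      · filter_upwards [Ioo_mem_nhdsGT h] with t ht _ using ht.2
      · exact Filter.Eventually.of_forall fun t h' => absurd h' h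
    obtain ⟨t, ht, ht'⟩ := (this.and self_mem_nhdsWithin).exists
    exact ⟨t, ht', ht⟩
  choose! τ' hτ' hτγ using hε
  have hsh : Shatters G (s.image p) := by
    rcases s.eq_empty_or_nonempty with rfl | ⟨i₀, _⟩
    · exact ⟨fun _ => 0, fun b _ => ⟨γ ∅, hγG ∅ (by simp), by simp⟩⟩
    have : Nonempty ι := ⟨i₀⟩
    let q := Function.invFunOn p (s : Set ι)
    have hq : ∀ i ∈ s, q (p i) = i := fun i hi =>
      hinj (Function.invFunOn_mem ⟨i, hi, rfl⟩) hi (Function.invFunOn_eq ⟨i, hi, rfl⟩)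
    refine ⟨fun a => τ' (q a), fun b hb => ?_⟩
    let t := s.filter fun i => b (p i) = 1
    have ht : t ⊆ s := Finset.filter_subset _ _
    refine ⟨γ t, hγG t ht, ?_⟩
    simp only [Finset.mem_image, forall_exists_index, and_imp, forall_apply_eq_imp_iff₂]
    intro i hi
    rw [hq i hi]
    have hbi := hb (p i) (Finset.mem_image_of_mem p hi)
    by_cases h1 : b (p i) = 1
    · have : i ∈ t := by simp [t, hi, h1]
      rw [h1, sign_eq_one_iff, sub_pos]
      exact hτγ i hi t (Finset.mem_powerset.2 ht) ((hγ t ht i hi).1 this)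
    · have : i ∉ t := by simp [t, h1]
      have h2 := (hγ t ht i hi).not.1 this
      have h3 : b (p i) = -1 := by
        revert hbi h1
        generalize b (p i) = c
        cases c <;> decide
      rw [h3, sign_eq_neg_one_iff, sub_neg]
      exact (not_lt.1 h2).trans_lt (hτ' i hi)
  have h1 : ((s.image p).card : ℕ∞) ≤ pdim G :=
    le_iSup (fun s : {s : Finset α // Shatters G s} => (s.1.card : ℕ∞)) ⟨_, hsh⟩
  rw [Finset.card_image_of_injOn hinj] at h1
  exact_mod_cast h1.trans hG

/-- Weighting by `r ^ d ≤ r ^ k` with `r = d / m ≤ 1` embeds the sum in the binomial expansion of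
`(1 + r) ^ m ≤ exp (r m) = exp d`. -/
theorem sum_choose_le_exp_pow {m d : ℕ} (hd : 0 < d) (hdm : d ≤ m) :
    ((∑ k ∈ Finset.Iic d, m.choose k : ℕ) : ℝ) ≤ (Real.exp 1 * m / d) ^ d := by
  have hd' : (0 : ℝ) < d := by exact_mod_cast hd
  have hm' : (0 : ℝ) < m := by exact_mod_cast hd.trans_le hdm
  set r : ℝ := d / m with hr
  have hr0 : 0 < r := by positivity
  have hr1 : r ≤ 1 := (div_le_one hm').2 (by exact_mod_cast hdm)
  have h1 : ((∑ k ∈ Finset.Iic d, m.choose k : ℕ) : ℝ) * r ^ d ≤ (r + 1) ^ m := by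
    push_cast
    rw [add_pow, Finset.sum_mul]
    calc ∑ k ∈ Finset.Iic d, (m.choose k : ℝ) * r ^ d
        ≤ ∑ k ∈ Finset.Iic d, r ^ k * 1 ^ (m - k) * (m.choose k : ℝ) := by
          refine Finset.sum_le_sum fun k hk => ?_
          rw [one_pow, mul_one, mul_comm]
          exact mul_le_mul_of_nonneg_right
            (pow_le_pow_of_le_one hr0.le hr1 (Finset.mem_Iic.1 hk)) (Nat.cast_nonneg _)
      _ ≤ _ := by
          refine Finset.sum_le_sum_of_subset_of_nonneg (fun k hk => ?_) fun _ _ _ => by positivity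
          have := Finset.mem_Iic.1 hk
          exact Finset.mem_range.2 (by omega)
  have h2 : (r + 1) ^ m ≤ Real.exp 1 ^ d := by
    calc (r + 1) ^ m ≤ Real.exp r ^ m := by
          gcongr
          exact Real.add_one_le_exp r
      _ = Real.exp 1 ^ d := by
          rw [← Real.exp_nat_mul, ← Real.exp_nat_mul, hr]
          congr 1
          field_simp
  have h3 : Real.exp 1 * m / d = Real.exp 1 / r := by
    rw [hr]
    field_simp
  rw [h3, div_pow, le_div_iff₀ (by positivity)]
  exact h1.trans h2

/-- Growth bound: the number of labellings of `m` points, with given thresholds, by a class of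
pseudo-dimension at most `d` (Sauer–Shelah). -/
theorem card_labellings_le {α ι : Type*} [Fintype ι] {G : Set (α → ℝ)} {d : ℕ}
    (hG : pdim G ≤ d) (hdm : d ≤ Fintype.card ι) (p : ι → α) (τ : ι → ℝ)
    (𝒜 : Finset (Finset ι)) (h𝒜 : ∀ s ∈ 𝒜, ∃ g ∈ G, ∀ i, i ∈ s ↔ τ i < g (p i)) :
    (𝒜.card : ℝ) ≤ (Real.exp 1 * Fintype.card ι / d) ^ d := by
  classical
  have h1 : 𝒜.card ≤ ∑ k ∈ Finset.Iic d, (Fintype.card ι).choose k :=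
    (𝒜.card_le_card_shatterer.trans Finset.card_shatterer_le_sum_vcDim).trans
      (Finset.sum_le_sum_of_subset
        (Finset.Iic_subset_Iic.2 (vcDim_le_of_pdim_le hG p τ 𝒜 h𝒜)))
  rcases Nat.eq_zero_or_pos d with rfl | hd
  · have : 𝒜.card ≤ 1 := by
      have h0 : Finset.Iic 0 = ({0} : Finset ℕ) := rfl
      simpa [h0] using h1
    simpa using this
  · exact (Nat.cast_le.2 h1).trans (sum_choose_le_exp_pow hd hdm)

/-! ### Random thresholds, random signs and exchange of points -/

/-- The indicator of `t < v`. -/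
noncomputable def above (t v : ℝ) : ℝ := if t < v then 1 else 0

theorem measurable_above {Ω : Type*} [MeasurableSpace Ω] {a b : Ω → ℝ} (ha : Measurable a)
    (hb : Measurable b) : Measurable fun ω => above (a ω) (b ω) :=
  Measurable.ite (measurableSet_lt ha hb) measurable_const measurable_const

theorem above_mem_Icc (t v : ℝ) : above t v ∈ Set.Icc (0 : ℝ) 1 := by
  unfold above
  split_ifs <;> simp

/-- The uniform distribution on `[0, 1]`. -/
noncomputable def unif : Measure ℝ := volume.restrict (Set.Icc 0 1)

instance : IsProbabilityMeasure unif := ⟨by simp [unif]⟩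

theorem integral_above {v : ℝ} (hv : v ∈ Set.Icc (0 : ℝ) 1) : ∫ t, above t v ∂unif = v := by
  have h1 : (fun t => above t v) = (Set.Iio v).indicator 1 := by
    ext t
    simp [above, Set.indicator]
  have h2 : Set.Iio v ∩ Set.Icc 0 1 = Set.Ico 0 v := by
    ext t
    simp only [Set.mem_inter_iff, Set.mem_Iio, Set.mem_Icc, Set.mem_Ico]
    exact ⟨fun h => ⟨h.2.1, h.1⟩, fun h => ⟨h.2, h.1, h.2.le.trans hv.2⟩⟩
  rw [h1, integral_indicator_one measurableSet_Iio, unif, measureReal_restrict_apply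
    measurableSet_Iio, h2]
  simp [hv.1]

/-- Moment bound for Rademacher sums. -/
theorem sum_exp_signs_le {ι : Type*} [Fintype ι] [DecidableEq ι] (c : ℝ) (a : ι → ℝ)
    (ha : ∀ k, |a k| ≤ 1) :
    ∑ σ : ι → Bool, Real.exp (c * ∑ k, (if σ k then 1 else -1) * a k) ≤
      2 ^ Fintype.card ι * Real.exp (Fintype.card ι * (c ^ 2 / 2)) := by
  have h1 : ∀ σ : ι → Bool, Real.exp (c * ∑ k, (if σ k then 1 else -1) * a k) =
      ∏ k, Real.exp (c * ((if σ k then 1 else -1) * a k)) := fun σ => by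
    rw [Finset.mul_sum, Real.exp_sum]
  simp_rw [h1]
  rw [← Fintype.prod_sum fun k (s : Bool) => Real.exp (c * ((if s then 1 else -1) * a k))]
  calc ∏ k, ∑ s : Bool, Real.exp (c * ((if s then 1 else -1) * a k))
      ≤ ∏ _k : ι, (2 * Real.exp (c ^ 2 / 2)) := by
        refine Finset.prod_le_prod (fun k _ => Finset.sum_nonneg fun _ _ => (Real.exp_pos _).le)
          fun k _ => ?_
        -- Each factor is a hyperbolic cosine, to which `cosh y ≤ exp (y² / 2)` applies.
        have h2 : ∑ s : Bool, Real.exp (c * ((if s then 1 else -1) * a k)) =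
            2 * Real.cosh (c * a k) := by
          rw [Real.cosh_eq]
          simp
          ring
        rw [h2]
        have h3 : (c * a k) ^ 2 ≤ c ^ 2 := by
          rw [mul_pow]
          exact mul_le_of_le_one_right (sq_nonneg c) ((sq_le_one_iff_abs_le_one _).2 (ha k))
        have h4 := (Real.cosh_le_exp_half_sq (c * a k)).trans
          (Real.exp_le_exp.2 (div_le_div_of_nonneg_right h3 zero_le_two))
        linarith
    _ = _ := by
        rw [Finset.prod_const, mul_pow, Finset.card_univ, ← Real.exp_nat_mul]

/-- Exchange of the sample point and the ghost point where `b` is false. -/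
def swapIf {X : Type*} (b : Bool) (w : X × (X × ℝ)) : X × (X × ℝ) :=
  if b then w else (w.2.1, (w.1, w.2.2))

theorem measurePreserving_swapIf {X : Type*} [MeasurableSpace X] (D : Measure X)
    [IsProbabilityMeasure D] (b : Bool) :
    MeasurePreserving (swapIf (X := X) b) (D.prod (D.prod unif)) (D.prod (D.prod unif)) := by
  cases b
  · have h1 := (measurePreserving_prodAssoc D D unif)
    have h2 := (Measure.measurePreserving_swap (μ := D) (ν := D)).prod
      (MeasurePreserving.id unif)
    exact (h1.comp h2).comp h1.symm
  · exact MeasurePreserving.id _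

/-! ### Symmetrization and the tail bound -/

section Tail

variable {X : Type*} [MeasurableSpace X] {ι J : Type*} [Fintype ι]

/-- The exponential moment of the thresholded ghost deviations, maximized over the class. -/
noncomputable def ghostMoment (u : J → ι → X → ℝ) (c : ℝ) (w : ι → X × (X × ℝ)) : ENNReal :=
  ⨆ j, ENNReal.ofReal (Real.exp
    (c * ∑ k, (above (w k).2.2 (u j k (w k).2.1) - above (w k).2.2 (u j k (w k).1))))

theorem measurable_ghostMoment [Countable J] {u : J → ι → X → ℝ}
    (hu : ∀ j k, Measurable (u j k)) (c : ℝ) : Measurable (ghostMoment u c) := by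
  refine Measurable.iSup fun j => ENNReal.measurable_ofReal.comp (Real.measurable_exp.comp
    (Measurable.const_mul (Finset.measurable_sum _ fun k _ => ?_) _))
  have hw : Measurable fun w : ι → X × (X × ℝ) => w k := measurable_pi_apply k
  exact (measurable_above hw.snd.snd ((hu j k).comp hw.snd.fst)).sub
    (measurable_above hw.snd.snd ((hu j k).comp hw.fst))

/-- Averaging over the threshold undoes the passage to indicators; the same threshold serves both
points, so that exchanging them only flips a sign. -/
theorem integral_thresholded (D : Measure X) [IsProbabilityMeasure D] {v : X → ℝ}
    (hv : Measurable v) (hv1 : ∀ x, v x ∈ Set.Icc (0 : ℝ) 1) (x : X) :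
    ∫ y, (above y.2 (v y.1) - above y.2 (v x)) ∂(D.prod unif) = ∫ y, v y ∂D - v x := by
  have hb : ∀ g : X × ℝ → ℝ, Measurable g →
      Integrable (fun y => above y.2 (g y)) (D.prod unif) := fun g hg =>
    Integrable.of_bound (C := 1) (measurable_above measurable_snd hg).aestronglyMeasurable
      (Eventually.of_forall fun y => by
        rw [Real.norm_eq_abs, abs_of_nonneg (above_mem_Icc _ _).1]
        exact (above_mem_Icc _ _).2)
  have h1 := hb (fun y => v y.1) (hv.comp measurable_fst)
  have h2 := hb (fun _ => v x) measurable_const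
  rw [integral_sub h1 h2, integral_prod _ h1, integral_prod _ h2]
  simp only [integral_above (hv1 _)]
  simp

/-- Jensen's inequality for `exp`: the deviation is the mean, over ghost points and thresholds, of
the difference of indicators. The supremum is taken inside the integral, so the right side does not
depend on `j`. -/
theorem exp_deviation_le (D : Measure X) [IsProbabilityMeasure D] {u : J → ι → X → ℝ}
    (hu : ∀ j k, Measurable (u j k)) (hu1 : ∀ j k x, u j k x ∈ Set.Icc (0 : ℝ) 1) (c : ℝ)
    (x : ι → X) (j : J) :
    ENNReal.ofReal (Real.exp (c * ∑ k, (∫ y, u j k y ∂D - u j k (x k)))) ≤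
      ∫⁻ y, ghostMoment u c (fun k => (x k, y k)) ∂(Measure.pi fun _ : ι => D.prod unif) := by
  set P := Measure.pi fun _ : ι => D.prod unif
  let Y : ι → X × ℝ → ℝ := fun k y => above y.2 (u j k y.1) - above y.2 (u j k (x k))
  have hYm : ∀ k, Measurable (Y k) := fun k =>
    (measurable_above measurable_snd ((hu j k).comp measurable_fst)).sub
      (measurable_above measurable_snd measurable_const)
  have hYb : ∀ k y, |Y k y| ≤ 1 := fun k y => by
    have h1 := above_mem_Icc y.2 (u j k y.1)
    have h2 := above_mem_Icc y.2 (u j k (x k))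
    exact abs_le.2 ⟨by linarith [h1.1, h2.2], by linarith [h1.2, h2.1]⟩
  have hYim : ∀ k, Measurable fun y : ι → X × ℝ => Y k (y k) := fun k =>
    (hYm k).comp (measurable_pi_apply k)
  have hSm : Measurable fun y : ι → X × ℝ => c * ∑ k, Y k (y k) :=
    (Finset.measurable_sum _ fun k _ => hYim k).const_mul c
  have hSb : ∀ y : ι → X × ℝ, |c * ∑ k, Y k (y k)| ≤ |c| * Fintype.card ι := fun y => by
    rw [abs_mul]
    refine mul_le_mul_of_nonneg_left ((Finset.abs_sum_le_sum_abs _ _).trans ?_) (abs_nonneg c)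
    simpa using Finset.sum_le_card_nsmul Finset.univ _ 1 fun k _ => hYb k (y k)
  have hSi : Integrable (fun y : ι → X × ℝ => c * ∑ k, Y k (y k)) P :=
    Integrable.of_bound hSm.aestronglyMeasurable _ (Eventually.of_forall hSb)
  have hEi : Integrable (fun y : ι → X × ℝ => Real.exp (c * ∑ k, Y k (y k))) P :=
    Integrable.of_bound (C := Real.exp (|c| * Fintype.card ι))
      (Real.measurable_exp.comp hSm).aestronglyMeasurable
      (Eventually.of_forall fun y => by
        rw [Real.norm_eq_abs, abs_of_pos (Real.exp_pos _)]
        exact Real.exp_le_exp.2 ((le_abs_self _).trans (hSb y)))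
  have hmean : ∫ y, c * ∑ k, Y k (y k) ∂P = c * ∑ k, (∫ y, u j k y ∂D - u j k (x k)) := by
    rw [integral_const_mul, integral_finsetSum]
    · congr 1
      refine Finset.sum_congr rfl fun k _ => ?_
      rw [← integral_thresholded D (hu j k) (hu1 j k) (x k)]
      exact integral_comp_eval (μ := fun _ : ι => D.prod unif) (i := k) (f := Y k)
        (hYm k).aestronglyMeasurable
    · intro k _
      exact Integrable.of_bound (C := 1) (hYim k).aestronglyMeasurable
        (Eventually.of_forall fun y => hYb k (y k))
  have hJ := convexOn_exp.map_integral_le (μ := P) Real.continuous_exp.continuousOn isClosed_univ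
    (Eventually.of_forall fun _ => Set.mem_univ _) hSi hEi
  rw [hmean] at hJ
  refine (ENNReal.ofReal_le_ofReal hJ).trans ?_
  rw [ofReal_integral_eq_lintegral_ofReal hEi (Eventually.of_forall fun _ => (Real.exp_pos _).le)]
  exact lintegral_mono fun y => le_iSup
    (fun j => ENNReal.ofReal (Real.exp
      (c * ∑ k, (above (y k).2 (u j k (y k).1) - above (y k).2 (u j k (x k)))))) j

-- With the points and thresholds frozen, a function enters only through its labelling of the `2N`
-- points. The supremum is thus at most a sum over at most `K` labellings, each a Rademacher sum in
-- `σ`.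
set_option linter.unusedSectionVars false in
theorem ghostMoment_swap_le [DecidableEq ι] (u : J → ι → X → ℝ) (c : ℝ) (K : ℝ)
    (hK : ∀ (p : ι × Bool → X) (τ : ι → ℝ) (𝒜 : Finset (Finset (ι × Bool))),
      (∀ s ∈ 𝒜, ∃ j, ∀ i, i ∈ s ↔ τ i.1 < u j i.1 (p i)) → (𝒜.card : ℝ) ≤ K)
    (w : ι → X × (X × ℝ)) :
    ∑ σ : ι → Bool, ghostMoment u c (fun k => swapIf (σ k) (w k)) ≤
      2 ^ Fintype.card ι *
        ENNReal.ofReal (K * Real.exp (Fintype.card ι * (c ^ 2 / 2))) := by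
  classical
  -- Index `(k, true)` is the ghost point and `(k, false)` the sample point; both use the threshold
  -- `τ k`.
  let p : ι × Bool → X := fun i => if i.2 then (w i.1).2.1 else (w i.1).1
  let τ : ι → ℝ := fun k => (w k).2.2
  let 𝒜 : Finset (Finset (ι × Bool)) :=
    Finset.univ.filter fun s => ∃ j, ∀ i, i ∈ s ↔ τ i.1 < u j i.1 (p i)
  let a : Finset (ι × Bool) → ι → ℝ := fun s k =>
    (if (k, true) ∈ s then 1 else 0) - (if (k, false) ∈ s then 1 else 0)
  have ha : ∀ s k, |a s k| ≤ 1 := by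
    intro s k
    simp only [a]
    split_ifs <;> simp
  have h1 : ∀ σ : ι → Bool, ghostMoment u c (fun k => swapIf (σ k) (w k)) ≤
      ∑ s ∈ 𝒜, ENNReal.ofReal (Real.exp (c * ∑ k, (if σ k then 1 else -1) * a s k)) := by
    intro σ
    refine iSup_le fun j => ?_
    let s : Finset (ι × Bool) := Finset.univ.filter fun i => τ i.1 < u j i.1 (p i)
    have hs : s ∈ 𝒜 := by
      simp only [𝒜, Finset.mem_filter, Finset.mem_univ, true_and]
      exact ⟨j, fun i => by simp [s]⟩
    refine le_trans (le_of_eq ?_) (Finset.single_le_sum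
      (f := fun s => ENNReal.ofReal (Real.exp (c * ∑ k, (if σ k then 1 else -1) * a s k)))
      (fun _ _ => zero_le) hs)
    congr 4
    ext k
    cases hσ : σ k <;> simp [hσ, swapIf, above, a, s, p, τ]
  calc ∑ σ : ι → Bool, ghostMoment u c (fun k => swapIf (σ k) (w k))
      ≤ ∑ σ : ι → Bool, ∑ s ∈ 𝒜,
          ENNReal.ofReal (Real.exp (c * ∑ k, (if σ k then 1 else -1) * a s k)) :=
        Finset.sum_le_sum fun σ _ => h1 σ
    _ = ENNReal.ofReal (∑ s ∈ 𝒜, ∑ σ : ι → Bool,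
          Real.exp (c * ∑ k, (if σ k then 1 else -1) * a s k)) := by
        rw [Finset.sum_comm, ENNReal.ofReal_sum_of_nonneg
          fun _ _ => Finset.sum_nonneg fun _ _ => (Real.exp_pos _).le]
        refine Finset.sum_congr rfl fun s _ => ?_
        rw [ENNReal.ofReal_sum_of_nonneg fun _ _ => (Real.exp_pos _).le]
    _ ≤ ENNReal.ofReal (2 ^ Fintype.card ι *
          (K * Real.exp (Fintype.card ι * (c ^ 2 / 2)))) := by
        refine ENNReal.ofReal_le_ofReal ?_
        refine (Finset.sum_le_card_nsmul _ _ _ fun s _ => sum_exp_signs_le c (a s) (ha s)).trans ?_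
        rw [nsmul_eq_mul]
        have := hK p τ 𝒜 fun s hs => (Finset.mem_filter.1 hs).2
        calc _ ≤ K * (2 ^ Fintype.card ι * Real.exp (Fintype.card ι * (c ^ 2 / 2))) := by
              gcongr
          _ = _ := by ring
    _ = _ := by
        rw [ENNReal.ofReal_mul (by positivity), ENNReal.ofReal_pow (by norm_num),
          ENNReal.ofReal_ofNat]

/-- Every exchange `σ` preserves the product measure, so the integral equals its average over all
`σ`, which is bounded pointwise in `w`. -/
theorem lintegral_ghostMoment_le [Countable J] (D : Measure X) [IsProbabilityMeasure D]
    {u : J → ι → X → ℝ} (hu : ∀ j k, Measurable (u j k)) (c : ℝ) (K : ℝ)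
    (hK : ∀ (p : ι × Bool → X) (τ : ι → ℝ) (𝒜 : Finset (Finset (ι × Bool))),
      (∀ s ∈ 𝒜, ∃ j, ∀ i, i ∈ s ↔ τ i.1 < u j i.1 (p i)) → (𝒜.card : ℝ) ≤ K) :
    ∫⁻ w, ghostMoment u c w ∂(Measure.pi fun _ : ι => D.prod (D.prod unif)) ≤
      ENNReal.ofReal (K * Real.exp (Fintype.card ι * (c ^ 2 / 2))) := by
  classical
  set P := Measure.pi fun _ : ι => D.prod (D.prod unif)
  have hm := measurable_ghostMoment hu c
  have hmp : ∀ σ : ι → Bool, MeasurePreserving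
      (fun (w : ι → X × (X × ℝ)) k => swapIf (σ k) (w k)) P P := fun σ =>
    measurePreserving_pi _ _ fun k => measurePreserving_swapIf D (σ k)
  have h1 : ∀ σ : ι → Bool, ∫⁻ w, ghostMoment u c (fun k => swapIf (σ k) (w k)) ∂P =
      ∫⁻ w, ghostMoment u c w ∂P := fun σ => (hmp σ).lintegral_comp hm
  have h2 : (2 : ENNReal) ^ Fintype.card ι * ∫⁻ w, ghostMoment u c w ∂P ≤
      2 ^ Fintype.card ι *
        ENNReal.ofReal (K * Real.exp (Fintype.card ι * (c ^ 2 / 2))) := by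
    calc (2 : ENNReal) ^ Fintype.card ι * ∫⁻ w, ghostMoment u c w ∂P
        = ∑ σ : ι → Bool, ∫⁻ w, ghostMoment u c (fun k => swapIf (σ k) (w k)) ∂P := by
          simp [h1]
      _ = ∫⁻ w, ∑ σ : ι → Bool, ghostMoment u c (fun k => swapIf (σ k) (w k)) ∂P :=
          (lintegral_finsetSum _ fun σ _ => hm.comp (hmp σ).measurable).symm
      _ ≤ ∫⁻ _w, 2 ^ Fintype.card ι *
            ENNReal.ofReal (K * Real.exp (Fintype.card ι * (c ^ 2 / 2))) ∂P :=
          lintegral_mono fun w => ghostMoment_swap_le u c K hK w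
      _ = _ := by simp [P]
  exact (ENNReal.mul_le_mul_iff_right (by simp) (by simp)).1 h2

/-- Uniform deviation bound: independent, not necessarily identically distributed terms
`u j k (x k)` with values in `[0, 1]`, for a countable class with growth bounded by `K`. -/
theorem measure_deviation_le [Countable J] (D : Measure X) [IsProbabilityMeasure D]
    {u : J → ι → X → ℝ} (hu : ∀ j k, Measurable (u j k))
    (hu1 : ∀ j k x, u j k x ∈ Set.Icc (0 : ℝ) 1) {ε : ℝ} (hε : 0 ≤ ε) (K : ℝ)
    (hK : ∀ (p : ι × Bool → X) (τ : ι → ℝ) (𝒜 : Finset (Finset (ι × Bool))),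
      (∀ s ∈ 𝒜, ∃ j, ∀ i, i ∈ s ↔ τ i.1 < u j i.1 (p i)) → (𝒜.card : ℝ) ≤ K) :
    (Measure.pi fun _ : ι => D)
        {x | ∃ j, Fintype.card ι * ε < ∑ k, (∫ y, u j k y ∂D - u j k (x k))} ≤
      ENNReal.ofReal (K * Real.exp (-(Fintype.card ι * (ε ^ 2 / 2)))) := by
  set N : ℝ := (Fintype.card ι : ℝ)
  set P := Measure.pi fun _ : ι => D
  let Φ : (ι → X) → ENNReal := fun x =>
    ∫⁻ y, ghostMoment u ε (fun k => (x k, y k)) ∂(Measure.pi fun _ : ι => D.prod unif)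
  have hm := measurable_ghostMoment hu ε
  let e := MeasurableEquiv.arrowProdEquivProdArrow X (X × ℝ) ι
  have hmp : MeasurePreserving e.symm (P.prod (Measure.pi fun _ : ι => D.prod unif))
      (Measure.pi fun _ : ι => D.prod (D.prod unif)) :=
    (measurePreserving_arrowProdEquivProdArrow X (X × ℝ) ι (fun _ => D)
      (fun _ => D.prod unif)).symm
  have hme : Measurable fun q : (ι → X) × (ι → X × ℝ) =>
      ghostMoment u ε (fun k => (q.1 k, q.2 k)) := hm.comp e.symm.measurable
  have hΦ : Measurable Φ := hme.lintegral_prod_right'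
  have hint : ∫⁻ x, Φ x ∂P ≤ ENNReal.ofReal (K * Real.exp (N * (ε ^ 2 / 2))) := by
    have h1 : ∫⁻ x, Φ x ∂P =
        ∫⁻ w, ghostMoment u ε w ∂(Measure.pi fun _ : ι => D.prod (D.prod unif)) := by
      rw [← hmp.lintegral_comp hm]
      exact (lintegral_prod _ hme.aemeasurable).symm
    rw [h1]
    exact lintegral_ghostMoment_le D hu ε K hK
  -- Markov's inequality with exponent `c = ε`, which minimizes `N c² / 2 - N c ε`.
  have hsub : {x : ι → X | ∃ j, N * ε < ∑ k, (∫ y, u j k y ∂D - u j k (x k))} ⊆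
      {x | ENNReal.ofReal (Real.exp (ε * (N * ε))) ≤ Φ x} := by
    rintro x ⟨j, hj⟩
    refine le_trans (ENNReal.ofReal_le_ofReal (Real.exp_le_exp.2 ?_))
      (exp_deviation_le D hu hu1 ε x j)
    exact mul_le_mul_of_nonneg_left hj.le hε
  refine (measure_mono hsub).trans ((meas_ge_le_lintegral_div hΦ.aemeasurable
    (by simp [Real.exp_pos]) ENNReal.ofReal_ne_top).trans ?_)
  refine (ENNReal.div_le_div_right hint _).trans ?_
  rw [← ENNReal.ofReal_div_of_pos (Real.exp_pos _), mul_div_assoc, ← Real.exp_sub]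
  refine ENNReal.ofReal_le_ofReal (le_of_eq ?_)
  congr 2
  ring

end Tail

/-! ### Calibration of the tail to the complexity term -/

/-- Dropping the cross term of `ε²` leaves `N ε² / 2 ≥ 4 d L + ln (1/δ)` with `L = ln (e N / d)`.
The part `4 d L` absorbs the growth function, including the factor `2 ^ d` due to the ghost sample,
because `L ≥ 1`. -/
theorem growth_mul_exp_le {d N : ℕ} (hN : 0 < N) (hdN : d ≤ N) {δ : ℝ} (hδ : 0 < δ)
    (hδ1 : δ ≤ 1) {ε : ℝ}
    (hε : ε = 2 * √(2 * d * Real.log (Real.exp 1 * N / d) / N) + 2 * √(Real.log (1 / δ) / (2 * N))) :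
    (Real.exp 1 * ((N * 2 : ℕ) : ℝ) / d) ^ d * Real.exp (-(N * (ε ^ 2 / 2))) ≤ δ := by
  have hN' : (0 : ℝ) < N := by exact_mod_cast hN
  set L := Real.log (Real.exp 1 * N / d) with hL
  set l := Real.log (1 / δ) with hl
  have hl0 : 0 ≤ l := Real.log_nonneg ((one_le_div hδ).2 hδ1)
  have hdL : 0 ≤ d * L ∧
      (Real.exp 1 * ((N * 2 : ℕ) : ℝ) / d) ^ d ≤ Real.exp (4 * (d * L)) := by
    rcases Nat.eq_zero_or_pos d with rfl | hd
    · simp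
    have hd' : (0 : ℝ) < d := by exact_mod_cast hd
    have h1 : Real.exp 1 ≤ Real.exp 1 * N / d := by
      rw [mul_div_assoc]
      exact le_mul_of_one_le_right (Real.exp_pos 1).le
        ((one_le_div hd').2 (by exact_mod_cast hdN))
    have hpos : 0 < Real.exp 1 * N / d := by positivity
    have hL1 : 1 ≤ L := (Real.le_log_iff_exp_le hpos).2 h1
    refine ⟨by positivity, ?_⟩
    have h2 : Real.exp 1 * ((N * 2 : ℕ) : ℝ) / d = 2 * Real.exp L := by
      rw [hL, Real.exp_log hpos]
      push_cast
      ring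
    have h3 : 2 * Real.exp L ≤ Real.exp (4 * L) := by
      have h4 : (2 : ℝ) ≤ Real.exp L := by linarith [Real.add_one_le_exp L]
      calc 2 * Real.exp L ≤ Real.exp L * Real.exp L := by gcongr
        _ = Real.exp (L + L) := (Real.exp_add L L).symm
        _ ≤ Real.exp (4 * L) := Real.exp_le_exp.2 (by linarith)
    calc (Real.exp 1 * ((N * 2 : ℕ) : ℝ) / d) ^ d ≤ Real.exp (4 * L) ^ d := by
          rw [h2]
          gcongr
      _ = Real.exp (4 * (d * L)) := by
          rw [← Real.exp_nat_mul]
          congr 1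
          ring
  have hε2 : 4 * (d * L) + l ≤ N * (ε ^ 2 / 2) := by
    have h1 := Real.sq_sqrt (x := 2 * d * L / N)
      (div_nonneg (by rw [mul_assoc]; exact mul_nonneg zero_le_two hdL.1) hN'.le)
    have h2 := Real.sq_sqrt (x := l / (2 * N)) (by positivity)
    have h3 := mul_nonneg (Real.sqrt_nonneg (2 * d * L / N)) (Real.sqrt_nonneg (l / (2 * N)))
    have h4 : 4 * (2 * d * L / N) + 4 * (l / (2 * N)) ≤ ε ^ 2 := by
      rw [hε]
      linear_combination 8 * h3 - 4 * h1 - 4 * h2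
    have h5 : N * ((4 * (2 * d * L / N) + 4 * (l / (2 * N))) / 2) = 4 * (d * L) + l := by
      field_simp
      ring
    rw [← h5]
    gcongr
  calc (Real.exp 1 * ((N * 2 : ℕ) : ℝ) / d) ^ d * Real.exp (-(N * (ε ^ 2 / 2)))
      ≤ Real.exp (4 * (d * L)) * Real.exp (-(4 * (d * L) + l)) := by
        gcongr
        exact hdL.2
    _ = Real.exp (-l) := by
        rw [← Real.exp_add]
        congr 1
        ring
    _ = δ := by rw [hl, one_div, Real.log_inv, neg_neg, Real.exp_log hδ]

/-- Uniform deviation bound for a countable part of a loss class of pseudo-dimension at most `d`,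
for independent data points `φ k (x k)`. -/
theorem measure_loss_deviation_le {X ι J α : Type*} [MeasurableSpace X] [Fintype ι] [Nonempty ι]
    [Countable J] (D : Measure X) [IsProbabilityMeasure D] {G : Set (α → ℝ)} {d : ℕ}
    (hG : pdim G ≤ d) (hd : d ≤ Fintype.card ι) (φ : ι → X → α) {g : J → α → ℝ}
    (hgG : ∀ j, g j ∈ G) (hgm : ∀ j k, Measurable fun x => g j (φ k x)) {M : ℝ}
    (hg0 : ∀ j k x, 0 ≤ g j (φ k x)) (hgM : ∀ j k x, g j (φ k x) ≤ M) {δ : ℝ} (hδ : 0 < δ)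
    (hδ1 : δ ≤ 1) :
    (Measure.pi fun _ : ι => D) {x | ∃ j, Fintype.card ι * (2 * complexity M d (Fintype.card ι) δ) <
      ∑ k, (∫ y, g j (φ k y) ∂D - g j (φ k (x k)))} ≤ ENNReal.ofReal δ := by
  set N := Fintype.card ι with hN
  have hN0 : 0 < N := Fintype.card_pos
  set ε := 2 * √(2 * d * Real.log (Real.exp 1 * N / d) / N) +
    2 * √(Real.log (1 / δ) / (2 * N)) with hε
  have hε0 : 0 ≤ ε := by positivity
  have hC : 2 * complexity M d N δ = M * ε := by
    rw [complexity, hε]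
    ring
  rcases isEmpty_or_nonempty J with hJ | ⟨⟨j₀⟩⟩
  · simp
  obtain ⟨x₀⟩ : Nonempty X := nonempty_of_isProbabilityMeasure D
  obtain ⟨k₀⟩ := ‹Nonempty ι›
  -- If `M = 0`, all losses vanish and the strict inequality cannot occur; otherwise the losses are
  -- rescaled to `[0, 1]`, and the thresholds with them.
  rcases ((hg0 j₀ k₀ x₀).trans (hgM j₀ k₀ x₀)).eq_or_lt with hM | hM
  · have h0 : ∀ j k x, g j (φ k x) = 0 := fun j k x =>
      le_antisymm (hM ▸ hgM j k x) (hg0 j k x)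
    rw [hC]
    simp [← hM, h0]
  let u : J → ι → X → ℝ := fun j k x => g j (φ k x) / M
  have hK : ∀ (p : ι × Bool → X) (τ : ι → ℝ) (𝒜 : Finset (Finset (ι × Bool))),
      (∀ s ∈ 𝒜, ∃ j, ∀ i, i ∈ s ↔ τ i.1 < u j i.1 (p i)) →
        (𝒜.card : ℝ) ≤ (Real.exp 1 * ((N * 2 : ℕ) : ℝ) / d) ^ d := by
    intro p τ 𝒜 h𝒜
    have hcard : Fintype.card (ι × Bool) = N * 2 := by simp [hN]
    rw [← hcard]
    refine card_labellings_le hG (by omega) (fun i => φ i.1 (p i)) (fun i => τ i.1 * M) 𝒜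
      fun s hs => ?_
    obtain ⟨j, hj⟩ := h𝒜 s hs
    exact ⟨g j, hgG j, fun i => (hj i).trans (lt_div_iff₀ hM)⟩
  have h1 := measure_deviation_le D (u := u) (fun j k => (hgm j k).div_const M)
    (fun j k x => ⟨div_nonneg (hg0 j k x) hM.le, (div_le_one hM).2 (hgM j k x)⟩) hε0 _ hK
  refine (measure_mono ?_).trans (h1.trans
    (ENNReal.ofReal_le_ofReal (growth_mul_exp_le hN0 hd hδ hδ1 hε)))
  rintro x ⟨j, hj⟩
  refine ⟨j, ?_⟩
  have h2 : ∑ k, (∫ y, u j k y ∂D - u j k (x k)) =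
      (∑ k, (∫ y, g j (φ k y) ∂D - g j (φ k (x k)))) / M := by
    rw [Finset.sum_div]
    refine Finset.sum_congr rfl fun k _ => ?_
    simp only [u]
    rw [integral_div, sub_div]
  rw [h2, lt_div_iff₀ hM]
  rw [hC] at hj
  linarith

theorem tendsto_complexity (M : ℝ) (d : ℕ) (δ : ℝ) :
    Tendsto (fun N : ℕ => complexity M d N δ) atTop (𝓝 0) := by
  have h1 : Tendsto (fun N : ℕ => 2 * (d : ℝ) * Real.log (Real.exp 1 * N / d) / N) atTop
      (𝓝 0) := by
    rcases Nat.eq_zero_or_pos d with rfl | hd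
    · simp
    have hd' : (0 : ℝ) < d := by exact_mod_cast hd
    have h2 : Tendsto (fun N : ℕ => Real.exp 1 / d * (N : ℝ)) atTop atTop :=
      tendsto_natCast_atTop_atTop.const_mul_atTop (by positivity)
    -- The limit `ln y / y → 0`, at `y = e N / d`.
    have h3 := ((Real.tendsto_pow_log_div_mul_add_atTop 1 0 1 one_ne_zero).comp h2).const_mul
      (2 * (d : ℝ) * (Real.exp 1 / d))
    rw [mul_zero] at h3
    refine h3.congr fun N => ?_
    have h4 : Real.exp 1 * N / d = Real.exp 1 / d * N := by ring
    rw [h4]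
    rcases Nat.eq_zero_or_pos N with rfl | hN
    · simp
    have hN' : (0 : ℝ) < N := by exact_mod_cast hN
    simp only [Function.comp, pow_one, one_mul, add_zero]
    field_simp
  have h2 : Tendsto (fun N : ℕ => Real.log (1 / δ) / (2 * (N : ℝ))) atTop (𝓝 0) :=
    tendsto_const_nhds.div_atTop (tendsto_natCast_atTop_atTop.const_mul_atTop zero_lt_two)
  have h3 := (h1.sqrt.const_mul M).add (h2.sqrt.const_mul M)
  simpa [complexity] using h3

/-! ### Reduction to countable subclasses -/

/-- A family in a second countable space has a countable subfamily on which all closed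
constraints can be tested. -/
theorem exists_countable_testing {S Y : Type*} [TopologicalSpace Y] [SecondCountableTopology Y]
    (e : S → Y) : ∃ Q : Set S, Q.Countable ∧ ∀ (Ψ : Y → ℝ) (c : ℝ), Continuous Ψ →
      (∀ s ∈ Q, Ψ (e s) ≤ c) → ∀ s, Ψ (e s) ≤ c := by
  let : TopologicalSpace S := TopologicalSpace.induced e inferInstance
  have he : Continuous e := continuous_induced_dom
  have : SecondCountableTopology S := TopologicalSpace.secondCountableTopology_induced S Y e
  obtain ⟨Q, hQ, hQd⟩ := TopologicalSpace.exists_countable_dense S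
  refine ⟨Q, hQ, fun Ψ c hΨ hc s => ?_⟩
  have hcl : IsClosed {s | Ψ (e s) ≤ c} := isClosed_le (hΨ.comp he) continuous_const
  exact hcl.closure_subset_iff.2 hc (hQd s)

theorem continuous_integral_continuousMap {X : Type*} [TopologicalSpace X] [CompactSpace X]
    [MeasurableSpace X] [OpensMeasurableSpace X] (D : Measure X) [IsProbabilityMeasure D] :
    Continuous fun v : C(X, ℝ) => ∫ x, v x ∂D := by
  have hi : ∀ v : C(X, ℝ), Integrable v D := fun v =>
    v.continuous.integrable_of_hasCompactSupport (HasCompactSupport.of_compactSpace _)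
  refine (LipschitzWith.of_dist_le_mul (K := 1) fun v w => ?_).continuous
  rw [Real.dist_eq, ← integral_sub (hi v) (hi w), NNReal.coe_one, one_mul]
  have := norm_integral_le_of_norm_le_const (μ := D) (f := fun x => v x - w x) (C := dist v w)
    (Eventually.of_forall fun x => by
      rw [← dist_eq_norm]
      exact ContinuousMap.dist_apply_le_dist x)
  simpa using this

/-- The summed deviation of the empirical from the true means is continuous in the losses. -/
theorem continuous_deviation {X ι : Type*} [Fintype ι] [TopologicalSpace X] [CompactSpace X]
    [MeasurableSpace X] [OpensMeasurableSpace X] (D : Measure X) [IsProbabilityMeasure D]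
    (x : ι → X) :
    Continuous fun v : ι → C(X, ℝ) => ∑ k, (∫ y, v k y ∂D - v k (x k)) :=
  continuous_finsetSum _ fun k _ =>
    ((continuous_integral_continuousMap D).comp (continuous_apply k)).sub
      ((continuous_eval_const (x k)).comp (continuous_apply k))

/-! ### Generalization bounds of the two stages -/

variable {nx ny nz : ℕ}

theorem continuousOn_pdeResidual {X : Set (E nx)} {f : E nx → E nx} (hf : ContinuousOn f X)
    {h : E nx → E ny} (hh : ContinuousOn h X) (A : Matrix (Fin nz) (Fin nz) ℝ)
    (B : Matrix (Fin nz) (Fin ny) ℝ) {θ : E nx → E nz} (hθ : ∀ x ∈ X, DifferentiableAt ℝ θ x)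
    (hθ' : ContinuousOn (fderiv ℝ θ) X) : ContinuousOn (pdeResidual f h A B θ) X := by
  have hθc : ContinuousOn θ X := fun x hx => (hθ x hx).continuousAt.continuousWithinAt
  exact ((hθ'.clm_apply hf).sub
    ((LinearMap.continuous_of_finiteDimensional (Matrix.toEuclideanLin A)).comp_continuousOn
      hθc)).sub
    ((LinearMap.continuous_of_finiteDimensional (Matrix.toEuclideanLin B)).comp_continuousOn hh)

/-- Uniform generalization bound of the first stage. -/
theorem exists_event_phys {X : Set (E nx)} (hX : IsCompact X) {Z : Set (E nz)}
    {f : E nx → E nx} (hf : ContinuousOn f X) {h : E nx → E ny} (hh : ContinuousOn h X)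
    (A : Matrix (Fin nz) (Fin nz) ℝ) (B : Matrix (Fin nz) (Fin ny) ℝ)
    {T : E nx → E nz} (hT : ContinuousOn T X) (hTZ : Set.MapsTo T X Z)
    (D : Measure X) [IsProbabilityMeasure D] {ν : ℝ} (hν : 0 < ν)
    {Nd Np : ℕ} (hNd : 0 < Nd) (hNp : 0 < Np) {H : Set (E nx → E nz)}
    (hH : ∀ θ ∈ H, (∀ x ∈ X, DifferentiableAt ℝ θ x) ∧ ContinuousOn (fderiv ℝ θ) X)
    {d : ℕ} (hd : pdim (physLossClass f h A B ν Nd Np X Z H) ≤ d) (hdN : d ≤ Nd + Np) {M : ℝ}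
    (hM : ∀ θ ∈ H, ∀ x ∈ X, physLoss f h A B ν Nd Np θ (Sum.inl (x, T x)) ≤ M ∧
      physLoss f h A B ν Nd Np θ (Sum.inr x) ≤ M) {δ : ℝ} (hδ : 0 < δ) (hδ1 : δ ≤ 1) :
    ∃ V : Set ((Fin Nd → X) × (Fin Np → X)), MeasurableSet V ∧
      ((Measure.pi fun _ : Fin Nd => D).prod (Measure.pi fun _ : Fin Np => D)) V ≤
        ENNReal.ofReal δ ∧
      ∀ S ∉ V, ∀ θ ∈ H,
        ∫ y : X, ‖T y - θ y‖ ^ 2 ∂D + ν * ∫ y : X, ‖pdeResidual f h A B θ y‖ ^ 2 ∂D ≤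
          empPhysRisk f h A B ν (labelled T S.1) (fun j => (S.2 j : E nx)) θ +
            2 * complexity M d (Nd + Np) δ := by
  have : CompactSpace X := isCompact_iff_compactSpace.1 hX
  have : Nonempty (Fin Nd ⊕ Fin Np) := ⟨Sum.inl ⟨0, hNd⟩⟩
  have hNd' : (0 : ℝ) < Nd := by exact_mod_cast hNd
  have hNp' : (0 : ℝ) < Np := by exact_mod_cast hNp
  -- Labelled and collocation points form one independent sample indexed by a sum type; the terms
  -- are not identically distributed, since `φ k` depends on the kind of `k`.
  let φ : Fin Nd ⊕ Fin Np → X → (X × Z) ⊕ X := fun k x =>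
    Sum.elim (fun _ => Sum.inl (x, ⟨T x, hTZ x.2⟩)) (fun _ => Sum.inr x) k
  let g : H → (X × Z) ⊕ X → ℝ := fun θ p =>
    physLoss f h A B ν Nd Np θ (Sum.map (fun q : X × Z => ((q.1 : E nx), (q.2 : E nz)))
      (fun x : X => (x : E nx)) p)
  have hgl : ∀ θ i x, g θ (φ (Sum.inl i) x) =
      ((Nd + Np : ℕ) : ℝ) / Nd * ‖T x - θ.1 x‖ ^ 2 := fun _ _ _ => rfl
  have hgr : ∀ θ j x, g θ (φ (Sum.inr j) x) =
      ((Nd + Np : ℕ) : ℝ) / Np * (ν * ‖pdeResidual f h A B θ.1 x‖ ^ 2) := fun _ _ _ => rfl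
  have hgc : ∀ θ k, Continuous fun x => g θ (φ k x) := by
    rintro θ (i | j)
    · have hθc : ContinuousOn θ.1 X := fun x hx =>
        ((hH θ θ.2).1 x hx).continuousAt.continuousWithinAt
      exact continuous_const.mul
        ((continuousOn_iff_continuous_domRestrict.1 (hT.sub hθc)).norm.pow 2)
    · exact continuous_const.mul (continuous_const.mul ((continuousOn_iff_continuous_domRestrict.1
        (continuousOn_pdeResidual hf hh A B (hH θ θ.2).1 (hH θ θ.2).2)).norm.pow 2))
  let e : H → Fin Nd ⊕ Fin Np → C(X, ℝ) := fun θ k => ⟨fun x => g θ (φ k x), hgc θ k⟩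
  obtain ⟨Q, hQ, hQt⟩ := exists_countable_testing e
  have : Countable Q := hQ.to_subtype
  set c : ℝ := Fintype.card (Fin Nd ⊕ Fin Np) *
    (2 * complexity M d (Fintype.card (Fin Nd ⊕ Fin Np)) δ) with hc
  let V : Set (Fin Nd ⊕ Fin Np → X) :=
    {x | ∃ θ : Q, c < ∑ k, (∫ y, g θ (φ k y) ∂D - g θ (φ k (x k)))}
  have hV : MeasurableSet V := by
    have : V = ⋃ θ : Q, {x | c < ∑ k, (∫ y, g θ (φ k y) ∂D - g θ (φ k (x k)))} := by
      ext x
      simp [V]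
    rw [this]
    refine MeasurableSet.iUnion fun θ => measurableSet_lt measurable_const
      (Finset.measurable_sum _ fun k _ => measurable_const.sub ?_)
    exact (hgc θ k).measurable.comp (measurable_pi_apply k)
  have hVδ : (Measure.pi fun _ => D) V ≤ ENNReal.ofReal δ := by
    refine measure_loss_deviation_le D hd (by simpa using hdN) φ (g := fun θ : Q => g θ)
      (fun θ => ⟨θ.1.1, θ.1.2, rfl⟩) (fun θ k => (hgc θ k).measurable) (M := M) ?_ ?_ hδ hδ1
    · rintro θ (i | j) x
      · rw [hgl]
        positivity
      · rw [hgr]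
        positivity
    · rintro θ (i | j) x
      · exact (hM θ.1 θ.1.2 x x.2).1
      · exact (hM θ.1 θ.1.2 x x.2).2
  let E' := (MeasurableEquiv.sumPiEquivProdPi fun _ : Fin Nd ⊕ Fin Np => X).symm
  have hE' : MeasurePreserving E' ((Measure.pi fun _ : Fin Nd => D).prod
      (Measure.pi fun _ : Fin Np => D)) (Measure.pi fun _ => D) :=
    measurePreserving_sumPiEquivProdPi_symm fun _ => D
  refine ⟨E' ⁻¹' V, E'.measurable hV, (hE'.measure_preimage hV.nullMeasurableSet).trans_le hVδ,
    fun S hS θ hθ => ?_⟩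
  have h1 : ∀ θ ∈ Q, ∑ k, (∫ y, e θ k y ∂D - e θ k (E' S k)) ≤ c := fun θ hθ =>
    not_lt.1 fun hlt => hS ⟨⟨θ, hθ⟩, hlt⟩
  have h2 := hQt (fun v => ∑ k, (∫ y, v k y ∂D - v k (E' S k))) c (continuous_deviation D _) h1
    ⟨θ, hθ⟩
  -- The weights `(Nd + Np) / Nd` and `(Nd + Np) / Np` cancel the numbers of points of each kind.
  have h3 : ∑ k, ∫ y, e ⟨θ, hθ⟩ k y ∂D = ((Nd + Np : ℕ) : ℝ) *
      (∫ y : X, ‖T y - θ y‖ ^ 2 ∂D + ν * ∫ y : X, ‖pdeResidual f h A B θ y‖ ^ 2 ∂D) := by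
    have hl : ∀ i, ∫ y, e ⟨θ, hθ⟩ (Sum.inl i) y ∂D =
        ((Nd + Np : ℕ) : ℝ) / Nd * ∫ y : X, ‖T y - θ y‖ ^ 2 ∂D := fun i =>
      integral_const_mul _ _
    have hr : ∀ j, ∫ y, e ⟨θ, hθ⟩ (Sum.inr j) y ∂D =
        ((Nd + Np : ℕ) : ℝ) / Np * (ν * ∫ y : X, ‖pdeResidual f h A B θ y‖ ^ 2 ∂D) := fun j =>
      (integral_const_mul _ _).trans (congrArg _ (integral_const_mul _ _))
    simp only [Fintype.sum_sum_type, hl, hr, Finset.sum_const, Finset.card_univ,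
      Fintype.card_fin, nsmul_eq_mul]
    field_simp
  have h4 : ∑ k, e ⟨θ, hθ⟩ k (E' S k) = ((Nd + Np : ℕ) : ℝ) *
      empPhysRisk f h A B ν (labelled T S.1) (fun j => (S.2 j : E nx)) θ := by
    rw [empPhysRisk_eq_average f h A B ν hNd, ← mul_assoc, mul_one_div_cancel (by positivity),
      one_mul]
    refine Finset.sum_congr rfl ?_
    rintro (i | j) - <;> rfl
  simp only [Finset.sum_sub_distrib] at h2
  rw [h3, h4, ← mul_sub, hc] at h2
  simp only [Fintype.card_sum, Fintype.card_fin] at h2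
  have := le_of_mul_le_mul_left h2 (by positivity)
  linarith

/-- Uniform generalization bound of the second stage, jointly measurable in the outcome `w` of the
first stage. -/
theorem exists_event_rec {X : Set (E nx)} (hX : IsCompact X) {Z : Set (E nz)}
    (D : Measure X) [IsProbabilityMeasure D] {W : Type*} [MeasurableSpace W] (P : Measure W)
    [IsProbabilityMeasure P] {ψ : W → E nx → E nz} (hψZ : ∀ w, Set.MapsTo (ψ w) X Z)
    (hψc : ∀ w, ContinuousOn (ψ w) X) (hψm : ∀ x ∈ X, Measurable fun w => ψ w x)
    {H : Set (E nz → E nx)} {ℓ : (E nz → E nx) → ℝ}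
    (hℓ : ∀ η ∈ H, 0 < ℓ η ∧ ∀ z ∈ Z, ∀ z' ∈ Z, ‖η z - η z'‖ ≤ ℓ η * ‖z - z'‖)
    {d N : ℕ} (hN : 0 < N) (hd : pdim (recLossClass X Z H) ≤ d) (hdN : d ≤ N) {M : ℝ}
    (hM : ∀ w, ∀ η ∈ H, ∀ x ∈ X, ‖x - η (ψ w x)‖ ^ 2 ≤ M) {δ : ℝ} (hδ : 0 < δ) (hδ1 : δ ≤ 1) :
    ∃ V : Set (W × (Fin N → X)), MeasurableSet V ∧
      (P.prod (Measure.pi fun _ : Fin N => D)) V ≤ ENNReal.ofReal δ ∧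
      ∀ S ∉ V, ∀ η ∈ H, ∫ y : X, ‖(y : E nx) - η (ψ S.1 y)‖ ^ 2 ∂D ≤
        empRecRisk (labelled (ψ S.1) S.2) η + 2 * complexity M d N δ := by
  have : CompactSpace X := isCompact_iff_compactSpace.1 hX
  have : Nonempty (Fin N) := ⟨⟨0, hN⟩⟩
  have hN' : (0 : ℝ) < N := by exact_mod_cast hN
  -- Continuous extensions off `Z` place the class in the second countable space `C(E nz, E nx)`, so
  -- that one countable subclass serves every first-stage outcome `w`.
  have hext : ∀ η : H, ∃ ζ : C(E nz, E nx), ∀ z ∈ Z, ζ z = η.1 z := by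
    rintro ⟨η, hη⟩
    have hL : LipschitzOnWith (ℓ η).toNNReal η Z := LipschitzOnWith.of_dist_le_mul
      fun z hz z' hz' => by
        rw [dist_eq_norm, dist_eq_norm, Real.coe_toNNReal _ (hℓ η hη).1.le]
        exact (hℓ η hη).2 z hz z' hz'
    obtain ⟨ζ, hζ, hζη⟩ := hL.extend_finite_dimension
    exact ⟨⟨ζ, hζ.continuous⟩, fun z hz => (hζη hz).symm⟩
  choose e he using hext
  let ψ' : W → C(X, E nz) := fun w => ⟨X.domRestrict (ψ w), (hψc w).domRestrict⟩
  -- A Carathéodory function, continuous in `x` and measurable in `w`, is jointly measurable.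
  have hψ' : Measurable fun q : W × X => ψ q.1 q.2 :=
    (measurable_uncurry_of_continuous_of_measurable (u := fun (x : X) w => ψ w x)
      (fun w => (hψc w).domRestrict) fun x => hψm x x.2).comp measurable_swap
  let L : C(E nz, E nx) → W → X → ℝ := fun ζ w x => ‖(x : E nx) - ζ (ψ w x)‖ ^ 2
  have hLm : ∀ ζ, Measurable fun q : W × X => L ζ q.1 q.2 := fun ζ =>
    ((measurable_subtype_coe.comp measurable_snd).sub
      (ζ.continuous.measurable.comp hψ')).norm.pow_const 2
  have hLe : ∀ (η : H) w x, L (e η) w x = ‖(x : E nx) - η.1 (ψ w x)‖ ^ 2 := fun η w x => by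
    simp only [L, he η _ (hψZ w x.2)]
  obtain ⟨Q, hQ, hQt⟩ := exists_countable_testing e
  have : Countable Q := hQ.to_subtype
  set c : ℝ := N * (2 * complexity M d N δ) with hc
  let V : Set (W × (Fin N → X)) :=
    {q | ∃ η : Q, c < ∑ k, (∫ y, L (e η) q.1 y ∂D - L (e η) q.1 (q.2 k))}
  have hV : MeasurableSet V := by
    have : V = ⋃ η : Q, {q | c < ∑ k, (∫ y, L (e η) q.1 y ∂D - L (e η) q.1 (q.2 k))} := by
      ext x
      simp [V]
    rw [this]
    refine MeasurableSet.iUnion fun η => measurableSet_lt measurable_const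
      (Finset.measurable_sum _ fun k _ => Measurable.sub ?_ ?_)
    · have h1 : Measurable fun w => ∫ y, L (e η) w y ∂D :=
        ((hLm (e η)).stronglyMeasurable.integral_prod_right' (ν := D)).measurable
      exact h1.comp measurable_fst
    · have h2 : Measurable fun q : W × (Fin N → X) => (q.1, q.2 k) :=
        measurable_fst.prodMk ((measurable_pi_apply k).comp measurable_snd)
      have h3 := (hLm (e η)).comp h2
      simpa only [Function.comp_def] using h3
  refine ⟨V, hV, ?_, fun S hS η hη => ?_⟩
  -- For fixed `w` the labels are a fixed function of the points, so each slice of `V` has measure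
  -- at most `δ`.
  · rw [Measure.prod_apply hV]
    refine (lintegral_mono (g := fun _ => ENNReal.ofReal δ) fun w => ?_).trans (by simp)
    have h1 := measure_loss_deviation_le D hd (by simpa using hdN)
      (fun (_ : Fin N) (x : X) => (x, (⟨ψ w x, hψZ w x.2⟩ : Z)))
      (g := fun (η : Q) p => ‖(p.1 : E nx) - η.1.1 p.2‖ ^ 2)
      (fun η => ⟨η.1.1, η.1.2, rfl⟩)
      (fun η k => by
        have := (hLm (e η)).comp (measurable_prodMk_left (x := w))
        simpa only [Function.comp_def, hLe] using this) (M := M)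
      (fun η k x => by positivity) (fun η k x => hM w η.1 η.1.2 x x.2) hδ hδ1
    simp only [Fintype.card_fin, ← hc] at h1
    simpa only [V, hLe, Set.preimage_ofPred_eq] using h1
  · have hΨ : Continuous fun ζ : C(E nz, E nx) =>
        ∑ k, (∫ y, L ζ S.1 y ∂D - L ζ S.1 (S.2 k)) := by
      have hcomp : Continuous fun ζ : C(E nz, E nx) => ζ.comp (ψ' S.1) :=
        ContinuousMap.continuous_precomp _
      let a : C(X, E nx) := ⟨Subtype.val, continuous_subtype_val⟩
      let b : C(E nx, ℝ) := ⟨fun v => ‖v‖ ^ 2, continuous_norm.pow 2⟩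
      have hv : Continuous fun ζ : C(E nz, E nx) => b.comp (a - ζ.comp (ψ' S.1)) :=
        (ContinuousMap.continuous_postcomp b).comp (continuous_const.sub hcomp)
      exact (continuous_deviation D S.2).comp (continuous_pi fun _ => hv)
    have h1 := hQt _ c hΨ (fun η hη => not_lt.1 fun hlt => hS ⟨⟨η, hη⟩, hlt⟩) ⟨η, hη⟩
    have h2 : ∑ k, ‖(S.2 k : E nx) - η (ψ S.1 (S.2 k))‖ ^ 2 =
        N * empRecRisk (labelled (ψ S.1) S.2) η := by
      rw [empRecRisk, ← mul_assoc, mul_one_div_cancel hN'.ne', one_mul]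
      rfl
    simp only [hLe, Finset.sum_sub_distrib, h2, Finset.sum_const, Finset.card_univ,
      Fintype.card_fin, nsmul_eq_mul] at h1
    rw [← mul_sub, hc] at h1
    have := le_of_mul_le_mul_left h1 hN'
    linarith

/-! ### Error decomposition and conclusion -/

/-- On compact `X` the continuous injective `T` is a closed embedding, so the change of variables
needs no measurability of `Tinv` or `η`. -/
theorem invError_eq_integral {X : Set (E nx)} (hX : IsCompact X) (D : Measure X)
    {T : E nx → E nz} (hT : ContinuousOn T X) {Tinv : E nz → E nx}
    (hTinv : Set.LeftInvOn Tinv T X) (η : E nz → E nx) :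
    invError D T Tinv η = ∫ x : X, ‖(x : E nx) - η (T x)‖ ^ 2 ∂D := by
  have : CompactSpace X := isCompact_iff_compactSpace.1 hX
  have hemb : MeasurableEmbedding fun x : X => T x :=
    (Continuous.isClosedEmbedding (continuousOn_iff_continuous_domRestrict.1 hT) fun x y hxy =>
      Subtype.ext (hTinv.injOn x.2 y.2 hxy)).measurableEmbedding
  rw [invError, hemb.integral_map]
  refine integral_congr_ae (Eventually.of_forall fun x => ?_)
  simp only [hTinv x.2]

/-- The inverse error is controlled by the reconstruction error along `θ` and the distance of
`θ` from `T`. -/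
theorem integral_inverse_le {X : Set (E nx)} (hX : IsCompact X) {Z : Set (E nz)} (D : Measure X)
    [IsProbabilityMeasure D] {T θ : E nx → E nz} (hT : ContinuousOn T X) (hTZ : Set.MapsTo T X Z)
    (hθ : ContinuousOn θ X) (hθZ : Set.MapsTo θ X Z) {η : E nz → E nx} {ℓ : ℝ} (hℓ0 : 0 ≤ ℓ)
    (hℓ : ∀ z ∈ Z, ∀ z' ∈ Z, ‖η z - η z'‖ ≤ ℓ * ‖z - z'‖) :
    ∫ x : X, ‖(x : E nx) - η (T x)‖ ^ 2 ∂D ≤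
      2 * ∫ x : X, ‖(x : E nx) - η (θ x)‖ ^ 2 ∂D +
        2 * ℓ ^ 2 * ∫ x : X, ‖T x - θ x‖ ^ 2 ∂D := by
  have : CompactSpace X := isCompact_iff_compactSpace.1 hX
  have hη : ContinuousOn η Z := (LipschitzOnWith.of_dist_le_mul (K := ℓ.toNNReal)
    fun z hz z' hz' => by
      rw [dist_eq_norm, dist_eq_norm, Real.coe_toNNReal _ hℓ0]
      exact hℓ z hz z' hz').continuousOn
  have hi : ∀ v : E nx → ℝ, ContinuousOn v X → Integrable (fun x : X => v x) D := fun v hv =>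
    (continuousOn_iff_continuous_domRestrict.1 hv).integrable_of_hasCompactSupport
      (HasCompactSupport.of_compactSpace _)
  have h1 := hi (fun x => ‖x - η (T x)‖ ^ 2) ((continuousOn_id.sub (hη.comp hT hTZ)).norm.pow 2)
  have h2 := hi (fun x => ‖x - η (θ x)‖ ^ 2) ((continuousOn_id.sub (hη.comp hθ hθZ)).norm.pow 2)
  have h3 := hi (fun x => ‖T x - θ x‖ ^ 2) ((hT.sub hθ).norm.pow 2)
  rw [← integral_const_mul, ← integral_const_mul,
    ← integral_add (h2.const_mul 2) (h3.const_mul (2 * ℓ ^ 2))]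
  refine integral_mono h1 ((h2.const_mul 2).add (h3.const_mul (2 * ℓ ^ 2))) fun x => ?_
  have h4 : ‖(x : E nx) - η (T x)‖ ≤ ‖(x : E nx) - η (θ x)‖ + ℓ * ‖T x - θ x‖ := by
    calc ‖(x : E nx) - η (T x)‖ = ‖((x : E nx) - η (θ x)) + (η (θ x) - η (T x))‖ := by
          rw [sub_add_sub_cancel]
      _ ≤ ‖(x : E nx) - η (θ x)‖ + ‖η (θ x) - η (T x)‖ := norm_add_le _ _
      _ ≤ _ := by
          rw [norm_sub_rev (T x)]
          gcongr
          exact hℓ _ (hθZ x.2) _ (hTZ x.2)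
  calc ‖(x : E nx) - η (T x)‖ ^ 2
      ≤ (‖(x : E nx) - η (θ x)‖ + ℓ * ‖T x - θ x‖) ^ 2 := by gcongr
    _ ≤ 2 * (‖(x : E nx) - η (θ x)‖ ^ 2 + (ℓ * ‖T x - θ x‖) ^ 2) := add_sq_le
    _ = 2 * ‖(x : E nx) - η (θ x)‖ ^ 2 + 2 * ℓ ^ 2 * ‖T x - θ x‖ ^ 2 := by ring

theorem sInf_image_eq_of_isMin {β : Type*} {R : β → ℝ} {s : Set β} {a : β}
    (ha : a ∈ s ∧ ∀ b ∈ s, R a ≤ R b) : sInf (R '' s) = R a :=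
  IsLeast.csInf_eq ⟨⟨a, ha.1, rfl⟩, by rintro _ ⟨b, hb, rfl⟩; exact ha.2 b hb⟩

theorem holdsWithProb_of_bad_events {Ω : Type*} [MeasurableSpace Ω] (P : Measure Ω)
    [IsProbabilityMeasure P] {V₁ V₂ : Set Ω} (h₁ : MeasurableSet V₁) (h₂ : MeasurableSet V₂)
    {δ : ℝ} (hδ : 0 ≤ δ) (hV₁ : P V₁ ≤ ENNReal.ofReal δ) (hV₂ : P V₂ ≤ ENNReal.ofReal δ)
    {good : Ω → Prop} (h : ∀ ω, ω ∉ V₁ → ω ∉ V₂ → good ω) :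
    HoldsWithProb P (1 - 2 * δ) good := by
  refine ⟨(V₁ ∪ V₂)ᶜ, (h₁.union h₂).compl, fun ω hω => ?_, ?_⟩
  · rw [Set.mem_compl_iff, Set.mem_union, not_or] at hω
    exact h ω hω.1 hω.2
  · rw [prob_compl_eq_one_sub (h₁.union h₂), ENNReal.ofReal_sub _ (by positivity),
      ENNReal.ofReal_one]
    refine tsub_le_tsub_left ?_ _
    rw [two_mul, ENNReal.ofReal_add hδ hδ]
    exact (measure_union_le _ _).trans (add_le_add hV₁ hV₂)

end KKL

theorem mainTheorem1 {nx ny nz : ℕ}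
    -- state space, observer space, system, observer matrices
    (X : Set (KKL.E nx)) (hX : IsCompact X) (Z : Set (KKL.E nz))
    (f : KKL.E nx → KKL.E nx) (hf : ContinuousOn f X)
    (h : KKL.E nx → KKL.E ny) (hh : ContinuousOn h X)
    (A : Matrix (Fin nz) (Fin nz) ℝ) (B : Matrix (Fin nz) (Fin ny) ℝ)
    -- the true map and its left inverse
    (T : KKL.E nx → KKL.E nz) (hT : ContinuousOn T X) (hTZ : Set.MapsTo T X Z)
    (Tinv : KKL.E nz → KKL.E nx) (hTinv : Set.LeftInvOn Tinv T X)
    -- the data distribution, the weight of the PDE term, the sample sizes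
    (D : Measure X) [IsProbabilityMeasure D] (ν : ℝ) (hν : 0 < ν)
    (Nd Np N₂ : ℕ) (hNd : 0 < Nd) (hNp : 0 < Np) (hN₂ : 0 < N₂)
    -- the hypothesis class of the forward map
    (Hθ : Set (KKL.E nx → KKL.E nz))
    (hHθZ : ∀ θ ∈ Hθ, Set.MapsTo θ X Z)
    (hHθ : ∀ θ ∈ Hθ, (∀ x ∈ X, DifferentiableAt ℝ θ x) ∧ ContinuousOn (fderiv ℝ θ) X)
    -- the hypothesis class of the inverse map, Lipschitz on `Z`
    (Hη : Set (KKL.E nz → KKL.E nx)) (ℓ : (KKL.E nz → KKL.E nx) → ℝ)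
    (hℓ : ∀ η ∈ Hη, 0 < ℓ η ∧ ∀ z ∈ Z, ∀ z' ∈ Z, ‖η z - η z'‖ ≤ ℓ η * ‖z - z'‖)
    -- finite pseudo-dimensions of the loss classes
    (dθ dη : ℕ)
    (hdθ : KKL.pdim (KKL.physLossClass f h A B ν Nd Np X Z Hθ) = dθ)
    (hdη : KKL.pdim (KKL.recLossClass X Z Hη) = dη)
    (hdθN : dθ ≤ Nd + Np) (hdηN : dη ≤ N₂)
    -- the first stage: a measurable choice of an empirical risk minimizer
    (learnθ : (Fin Nd → X) × (Fin Np → X) → KKL.E nx → KKL.E nz)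
    (hlearnθ : ∀ S₁, learnθ S₁ ∈ Hθ ∧ ∀ θ ∈ Hθ,
      KKL.empPhysRisk f h A B ν (KKL.labelled T S₁.1) (fun j => (S₁.2 j : KKL.E nx)) (learnθ S₁) ≤
        KKL.empPhysRisk f h A B ν (KKL.labelled T S₁.1) (fun j => (S₁.2 j : KKL.E nx)) θ)
    (hlearnθ_meas : ∀ x ∈ X, Measurable fun S₁ => learnθ S₁ x)
    -- the second stage: an empirical risk minimizer on data labelled by the learned forward map
    (learnη : (Fin Nd → X) × (Fin Np → X) → (Fin N₂ → X) → KKL.E nz → KKL.E nx)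
    (hlearnη : ∀ S₁ S₂, learnη S₁ S₂ ∈ Hη ∧ ∀ η ∈ Hη,
      KKL.empRecRisk (KKL.labelled (learnθ S₁) S₂) (learnη S₁ S₂) ≤
        KKL.empRecRisk (KKL.labelled (learnθ S₁) S₂) η)
    -- bounds on the losses
    (Mθ Mη : ℝ)
    (hMθ : ∀ θ ∈ Hθ, ∀ x ∈ X,
      KKL.physLoss f h A B ν Nd Np θ (Sum.inl (x, T x)) ≤ Mθ ∧
      KKL.physLoss f h A B ν Nd Np θ (Sum.inr x) ≤ Mθ)
    (hMη : ∀ S₁, ∀ η ∈ Hη, ∀ x ∈ X, ‖x - η (learnθ S₁ x)‖ ^ 2 ≤ Mη)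
    (δ : ℝ) (hδ : 0 < δ) :
    KKL.HoldsWithProb
      (((Measure.pi fun _ : Fin Nd => D).prod (Measure.pi fun _ : Fin Np => D)).prod
        (Measure.pi fun _ : Fin N₂ => D))
      (1 - 2 * δ)
      (fun S =>
        KKL.invError D T Tinv (learnη S.1 S.2) ≤
          2 * (sInf (KKL.empRecRisk (KKL.labelled (learnθ S.1) S.2) '' Hη) +
            2 * KKL.complexity Mη dη N₂ δ) +
          2 * ℓ (learnη S.1 S.2) ^ 2 *
            (sInf (KKL.empPhysRisk f h A B ν (KKL.labelled T S.1.1)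
                (fun j => (S.1.2 j : KKL.E nx)) '' Hθ) +
              2 * KKL.complexity Mθ dθ (Nd + Np) δ)) ∧
    Tendsto (fun N : ℕ => KKL.complexity Mη dη N δ) atTop (𝓝 0) ∧
    Tendsto (fun N : ℕ => KKL.complexity Mθ dθ N δ) atTop (𝓝 0) := by
  refine ⟨?_, KKL.tendsto_complexity _ _ _, KKL.tendsto_complexity _ _ _⟩
  -- For `δ > 1` the required probability is negative and the empty event suffices.
  rcases lt_or_ge 1 δ with hδ1 | hδ1
  · exact ⟨∅, MeasurableSet.empty, fun _ hω => hω.elim,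
      by rw [ENNReal.ofReal_of_nonpos (by linarith)]; exact zero_le⟩
  have hθc : ∀ θ ∈ Hθ, ContinuousOn θ X := fun θ hθ x hx =>
    ((hHθ θ hθ).1 x hx).continuousAt.continuousWithinAt
  obtain ⟨V₁, hV₁, hV₁δ, hgood₁⟩ := KKL.exists_event_phys hX hf hh A B hT hTZ D hν hNd hNp hHθ
    hdθ.le hdθN hMθ hδ hδ1
  obtain ⟨V₂, hV₂, hV₂δ, hgood₂⟩ := KKL.exists_event_rec hX D
    ((Measure.pi fun _ : Fin Nd => D).prod (Measure.pi fun _ : Fin Np => D))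
    (fun S₁ => hHθZ _ (hlearnθ S₁).1) (fun S₁ => hθc _ (hlearnθ S₁).1) hlearnθ_meas hℓ hN₂
    hdη.le hdηN hMη hδ hδ1
  refine KKL.holdsWithProb_of_bad_events _ (hV₁.preimage measurable_fst) hV₂ hδ.le
    ((measurePreserving_fst.measure_preimage hV₁.nullMeasurableSet).trans_le hV₁δ) hV₂δ
    fun S hS₁ hS₂ => ?_
  have hθ := hlearnθ S.1
  have hη := hlearnη S.1 S.2
  have h₁ := hgood₁ S.1 hS₁ _ hθ.1
  have h₂ := hgood₂ S hS₂ _ hη.1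
  -- Allows the PDE part of the true first-stage risk to be discarded.
  have hpde : 0 ≤ ν * ∫ y : X, ‖KKL.pdeResidual f h A B (learnθ S.1) y‖ ^ 2 ∂D :=
    mul_nonneg hν.le (integral_nonneg fun _ => sq_nonneg _)
  rw [KKL.invError_eq_integral hX D hT hTinv, KKL.sInf_image_eq_of_isMin hη,
    KKL.sInf_image_eq_of_isMin hθ]
  refine (KKL.integral_inverse_le hX D hT hTZ (hθc _ hθ.1) (hHθZ _ hθ.1) (hℓ _ hη.1).1.le
    (hℓ _ hη.1).2).trans ?_
  gcongr
  linarith
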